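/- Let $(G,+)$ be an abelian group and let $f,g,h:G\to\mathbb{C}$ be functions. Write $\mathcal{B}(G)$ for the space of bounded functions $G\to\mathbb{C}$. A function $m:G\to\mathbb{C}$ is called multiplicative if $m(x+y)=m(x)m(y)$ for all $x,y\in G$, and a function $a:G\to\mathbb{C}$ is called additive if $a(x+y)=a(x)+a(y)$ for all $x,y\in G$. Suppose that $f$ and $h$ are linearly independent modulo $\mathcal{B}(G)$, that is, for $\lambda_1,\lambda_2\in\mathbb{C}$, $\lambda_1 f+\lambda_2 h\in\mathcal{B}(G)$ implies $\lambda_1=\lambda_2=0$. Suppose also that the function $$(x,y)\mapsto f(x+y)-f(x)g(y)-g(x)f(y)-h(x)h(y)$$ is bounded on $G\times G$. Then at least one of the following holds. (1) There are a bounded function $b:G\to\mathbb{C}$, constants $\rho\in\mathbb{C}$ and $\lambda\in\mathbb{C}\setminus\{0\}$, and functions $f_0,g_0:G\to\mathbb{C}$ satisfying $f_0(x+y)=f_0(x)f_0(y)-g_0(x)g_0(y)$ for all $x,y\in G$, such that $$f=-\lambda^2f_0+\lambda^2b,\qquad g=\tfrac{1+\rho^2}{2}f_0+\rho g_0+\tfrac{1-\rho^2}{2}b,\qquad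 h=\lambda\rho f_0+\lambda g_0-\lambda\rho b.$$ (2) There are a nonzero bounded multiplicative function $m:G\to\mathbb{C}$, an unbounded multiplicative function $M:G\to\mathbb{C}$, a nonzero additive function $a:G\to\mathbb{C}$, a bounded function $b:G\to\mathbb{C}$, and constants $\beta\in\mathbb{C}$ and $\lambda\in\mathbb{C}\setminus\{0\}$ such that $$f=\lambda^2M+am+b,$$ $$g=\beta\lambda\left(1-\tfrac12\beta\lambda\right)M+(1-\beta\lambda)m-\tfrac12\beta^2am-\tfrac12\beta^2b,$$ $$h=\lambda(1-\beta\lambda)M-\lambda m-\beta am-\beta b.$$ (3) There are a nonzero bounded multiplicative function $m:G\to\mathbb{C}$, additive functions $a,a_1:G\to\mathbb{C}$ with $a\neq0$, a bounded function $b:G\to\mathbb{C}$ and a constant $\beta\in\mathbb{C}$ such that $$f=\tfrac12a^2m+\tfrac12a_1m+b,$$ $$g=-\tfrac14\beta^2a^2m+\beta am-\tfrac14\beta^2a_1m+m-\tfrac12\beta^2b,$$ $$h=-\tfrac12\beta a^2m+am-\tfrac12\beta a_1m-\beta b.$$ (4) There are a nonzero bounded multiplicative function $m:G\to\mathbb{C}$,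 a nonzero additive function $a:G\to\mathbb{C}$, a bounded function $b:G\to\mathbb{C}$ and a constant $\beta\in\mathbb{C}$ such that $$f(x+y)=f(x)m(y)+m(x)f(y)+(a(x)m(x)+b(x))(a(y)m(y)+b(y))\quad\text{for all }x,y\in G,$$ $$g=-\tfrac12\beta^2f+(1+\beta a)m+\beta b,\qquad h=-\beta f+am+b.$$ (5) $f(x+y)=f(x)g(y)+g(x)f(y)+h(x)h(y)$ for all $x,y\in G$. -/

import Mathlib

namespace TrigStability

/-- The linear space `B(X)` of all bounded complex-valued functions on `X`. -/
def boundedFunctions (X : Type*) : Submodule ℂ (X → ℂ) where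
  carrier := {f | ∃ C : ℝ, ∀ x, ‖f x‖ ≤ C}
  add_mem' := by
    rintro f g ⟨C, hC⟩ ⟨D, hD⟩
    exact ⟨C + D, fun x => (norm_add_le _ _).trans (add_le_add (hC x) (hD x))⟩
  zero_mem' := ⟨0, fun x => by simp⟩
  smul_mem' := by
    rintro c f ⟨C, hC⟩
    refine ⟨‖c‖ * C, fun x => ?_⟩
    simpa using mul_le_mul_of_nonneg_left (hC x) (norm_nonneg c)

/-- `F 0, …, F (n - 1)` are linearly independent modulo the linear space `V`: a linear combination
of them belongs to `V` only if all its coefficients vanish. -/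
def LinIndepModulo {X : Type*} (V : Submodule ℂ (X → ℂ)) {n : ℕ} (F : Fin n → X → ℂ) : Prop :=
  ∀ c : Fin n → ℂ, ∑ i, c i • F i ∈ V → ∀ i, c i = 0

/-- Multiplicative functions on an additive group: `m (x + y) = m x * m y`. The zero function is
allowed. -/
def IsMultiplicative {G : Type*} [AddCommGroup G] (m : G → ℂ) : Prop :=
  ∀ x y, m (x + y) = m x * m y

/-- Additive functions: `a (x + y) = a x + a y`. -/
def IsAdditive {G : Type*} [AddCommGroup G] (a : G → ℂ) : Prop :=
  ∀ x y, a (x + y) = a x + a y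

end TrigStability

namespace TrigStability

/-! ### Calculus of bounded functions; independence modulo them. -/

section Bounded

variable {X Y : Type*} {u v : X → ℂ}

/-! If `f`, `g`, `h` are independent modulo bounded functions, comparing the two expansions of `f (x
+ y + z)` forces the defect to vanish: `defect_eq_zero_of_indep`, alternative (5). Otherwise `g = α
f + β h + m` with `m` bounded. With `k = h + β f` the equation becomes `f (x + y) = (2α - β²) f x f
y + f x m y + m x f y + k x k y` up to a bounded term. If `2α - β² ≠ 0`, completing the square gives
a cosine equation with bounded defect, exact by `cosine_defect_eq_zero`: alternative (1). If `2α -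
β² = 0`, `exists_of_bdd_coefficient` makes `m` multiplicative and gives `k` an exact addition law
with a constant `q`. Then `f / m` has, up to a bounded term, an explicit Cauchy difference, and
Hyers' theorem yields (3) for `q = 0` and (2) for `q ≠ 0`. Alternative (4) is never needed. -/

theorem bdd_const (c : ℂ) : (fun _ : X => c) ∈ boundedFunctions X := ⟨‖c‖, fun _ => le_rfl⟩

theorem bdd_add (hu : u ∈ boundedFunctions X) (hv : v ∈ boundedFunctions X) :
    (fun x => u x + v x) ∈ boundedFunctions X := add_mem hu hv

theorem bdd_sub (hu : u ∈ boundedFunctions X) (hv : v ∈ boundedFunctions X) :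
    (fun x => u x - v x) ∈ boundedFunctions X := sub_mem hu hv

theorem bdd_mul (hu : u ∈ boundedFunctions X) (hv : v ∈ boundedFunctions X) :
    (fun x => u x * v x) ∈ boundedFunctions X := by
  obtain ⟨C, hC⟩ := hu
  obtain ⟨D, hD⟩ := hv
  exact ⟨C * D, fun x => (norm_mul_le _ _).trans
    (mul_le_mul (hC x) (hD x) (norm_nonneg _) ((norm_nonneg _).trans (hC x)))⟩

theorem bdd_const_mul (c : ℂ) (hu : u ∈ boundedFunctions X) :
    (fun x => c * u x) ∈ boundedFunctions X := bdd_mul (bdd_const c) hu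

theorem bdd_mul_const (hu : u ∈ boundedFunctions X) (c : ℂ) :
    (fun x => u x * c) ∈ boundedFunctions X := bdd_mul hu (bdd_const c)

theorem bdd_comp (hu : u ∈ boundedFunctions X) (φ : Y → X) :
    (fun y => u (φ y)) ∈ boundedFunctions Y := by
  obtain ⟨C, hC⟩ := hu
  exact ⟨C, fun y => hC (φ y)⟩

theorem bdd_congr (hu : u ∈ boundedFunctions X) (h : ∀ x, v x = u x) :
    v ∈ boundedFunctions X := by
  rwa [funext h]

/-- Two functions are linearly independent modulo bounded functions. -/
def IndepPair (f h : X → ℂ) : Prop :=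
  ∀ a b : ℂ, (fun x => a * f x + b * h x) ∈ boundedFunctions X → a = 0 ∧ b = 0

/-- Vanishing of all these determinants would be a linear relation between `f` and `h` for each
fixed `z`. -/
theorem IndepPair.exists_det_ne_zero {f h : X → ℂ} (hfh : IndepPair f h) :
    ∃ z w, f z * h w - f w * h z ≠ 0 := by
  by_contra! H
  have hf : ∀ z, f z = 0 := fun z => by
    have := (hfh (-h z) (f z) (bdd_congr (bdd_const 0) fun w => by linear_combination H z w)).2
    exact this
  exact one_ne_zero (hfh 1 0 (bdd_congr (bdd_const 0) fun w => by simp [hf])).1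

theorem IndepPair.exists_ne_zero {f h : X → ℂ} (hfh : IndepPair f h) : ∃ z, h z ≠ 0 := by
  by_contra! H
  exact one_ne_zero (hfh 0 1 (bdd_congr (bdd_const 0) fun w => by simp [H])).2

theorem IndepPair.eq_zero_of_mul_bdd {f h : X → ℂ} (hfh : IndepPair f h) {c : ℂ}
    (hc : (fun x => c * h x) ∈ boundedFunctions X) : c = 0 :=
  (hfh 0 c (bdd_congr hc fun x => by ring)).2

end Bounded

/-! ### Functional equations with bounded defect. -/

section Equations

variable {G : Type*} [AddCommGroup G]

/-- If `f, g, h` are linearly independent modulo bounded functions, a bounded defect of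
`f (x + y) = f x * g y + g x * f y + h x * h y` vanishes. -/
theorem defect_eq_zero_of_indep {f g h : G → ℂ} (hfh : IndepPair f h)
    (hind : ∀ a b c : ℂ, (fun x => a * f x + b * g x + c * h x) ∈ boundedFunctions G →
      a = 0 ∧ b = 0 ∧ c = 0)
    {T : G × G → ℂ} (hT : T ∈ boundedFunctions (G × G))
    (hf : ∀ x y, f (x + y) = f x * g y + g x * f y + h x * h y + T (x, y)) (x y : G) :
    T (x, y) = 0 := by
  obtain ⟨z, w, hD⟩ := hfh.exists_det_ne_zero
  set D := f z * h w - f w * h z with hDdef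
  set E : G → G × G → ℂ := fun z p =>
    T (p.1, p.2 + z) - T (p.1, p.2) * g z - T (p.1 + p.2, z) with hE
  have hEb : ∀ z, E z ∈ boundedFunctions (G × G) := fun z =>
    bdd_sub (bdd_sub (bdd_comp hT fun p : G × G => (p.1, p.2 + z)) (bdd_mul_const hT _))
      (bdd_comp hT fun p : G × G => (p.1 + p.2, z))
  have assoc : ∀ x y z, f z * g (x + y) + h z * h (x + y) = f x * (g (y + z) - g y * g z)
      + g x * (f (y + z) - f y * g z) + h x * (h (y + z) - h y * g z) + E z (x, y) := by
    intro x y z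
    have e := hf (x + y) z
    rw [add_assoc, hf x (y + z), hf x y] at e
    simp only [hE]
    linear_combination -e
  have key : ∀ c d : ℂ, ∃ (k₁ k₂ k₃ : G → ℂ) (R : G × G → ℂ), R ∈ boundedFunctions (G × G) ∧
      ∀ x y, (c * f z + d * f w) * g (x + y) + (c * h z + d * h w) * h (x + y)
        = f x * k₁ y + g x * k₂ y + h x * k₃ y + R (x, y) := fun c d =>
    ⟨fun y => c * (g (y + z) - g y * g z) + d * (g (y + w) - g y * g w),
      fun y => c * (f (y + z) - f y * g z) + d * (f (y + w) - f y * g w),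
      fun y => c * (h (y + z) - h y * g z) + d * (h (y + w) - h y * g w),
      fun p => c * E z p + d * E w p,
      bdd_add (bdd_const_mul _ (hEb z)) (bdd_const_mul _ (hEb w)), fun x y => by
        linear_combination c * assoc x y z + d * assoc x y w⟩
  -- Cramer's rule: `assoc` at `z` and `w` is solved for `g (x + y)` and `h (x + y)`.
  obtain ⟨k₁, k₂, k₃, R, hR, hg⟩ := key (h w / D) (-h z / D)
  obtain ⟨l₁, l₂, l₃, S, hS, hh⟩ := key (-f w / D) (f z / D)
  have i₁ : h w / D * f z + -h z / D * f w = 1 := by field_simp; rw [hDdef]; ring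
  have i₂ : h w / D * h z + -h z / D * h w = 0 := by field_simp; ring
  have i₃ : -f w / D * f z + f z / D * f w = 0 := by field_simp; ring
  have i₄ : -f w / D * h z + f z / D * h w = 1 := by field_simp; rw [hDdef]; ring
  simp only [i₁, i₂, one_mul, zero_mul, add_zero] at hg
  simp only [i₃, i₄, one_mul, zero_mul, zero_add] at hh
  -- Substituting back and fixing `y`, `z`, independence in `x` kills the coefficients; only the
  -- bounded parts remain.
  have hEeq : ∀ x y z, E z (x, y) = f z * R (x, y) + h z * S (x, y) := by
    intro x y z
    obtain ⟨c₁, c₂, c₃⟩ := hind (f z * k₁ y + h z * l₁ y - (g (y + z) - g y * g z))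
      (f z * k₂ y + h z * l₂ y - (f (y + z) - f y * g z))
      (f z * k₃ y + h z * l₃ y - (h (y + z) - h y * g z))
      (bdd_congr (bdd_comp (bdd_sub (hEb z) (bdd_add (bdd_const_mul (f z) hR)
        (bdd_const_mul (h z) hS))) fun x => (x, y)) fun x => by
          linear_combination assoc x y z - f z * hg x y - h z * hh x y)
    linear_combination f z * hg x y + h z * hh x y - assoc x y z + f x * c₁ + g x * c₂ + h x * c₃
  -- Now `z` varies: `T (x, y)` is the coefficient of `g z` in a bounded combination.
  exact (hind (R (x, y)) (T (x, y)) (S (x, y)) (bdd_congr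
    (bdd_sub (bdd_comp hT fun z => (x, y + z)) (bdd_comp hT fun z => (x + y, z))) fun z => by
      have := hEeq x y z
      simp only [hE] at this
      linear_combination -this)).2.1

/-- Superstability of the cosine equation: if `f, g` are linearly independent modulo bounded
functions, a bounded defect of `f (x + y) = f x * f y - g x * g y` vanishes. -/
theorem cosine_defect_eq_zero {f g : G → ℂ} (hfg : IndepPair f g)
    {T : G × G → ℂ} (hT : T ∈ boundedFunctions (G × G))
    (hf : ∀ x y, f (x + y) = f x * f y - g x * g y + T (x, y)) (x y : G) :
    T (x, y) = 0 := by
  obtain ⟨w, hw⟩ := hfg.exists_ne_zero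
  set E : G → G × G → ℂ := fun z p =>
    T (p.1 + p.2, z) + T (p.1, p.2) * f z - T (p.1, p.2 + z) with hE
  have hEb : ∀ z, E z ∈ boundedFunctions (G × G) := fun z =>
    bdd_sub (bdd_add (bdd_comp hT fun p : G × G => (p.1 + p.2, z)) (bdd_mul_const hT _))
      (bdd_comp hT fun p : G × G => (p.1, p.2 + z))
  have assoc : ∀ x y z, g z * g (x + y) = f x * (f y * f z - f (y + z))
      + g x * (g (y + z) - g y * f z) + E z (x, y) := by
    intro x y z
    have e := hf (x + y) z
    rw [add_assoc, hf x (y + z), hf x y] at e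
    simp only [hE]
    linear_combination e
  -- Only `g (x + y)` is unknown here, so one point `w` with `g w ≠ 0` suffices.
  obtain ⟨k, l, R, hR, hg⟩ : ∃ (k l : G → ℂ) (R : G × G → ℂ), R ∈ boundedFunctions (G × G) ∧
      ∀ x y, g (x + y) = f x * k y + g x * l y + R (x, y) :=
    ⟨fun y => (g w)⁻¹ * (f y * f w - f (y + w)), fun y => (g w)⁻¹ * (g (y + w) - g y * f w),
      fun p => (g w)⁻¹ * E w p, bdd_const_mul _ (hEb w), fun x y => by
        have := assoc x y w
        field_simp
        linear_combination this⟩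
  have hEeq : ∀ x y z, E z (x, y) = g z * R (x, y) := by
    intro x y z
    obtain ⟨c₁, c₂⟩ := hfg (g z * k y - (f y * f z - f (y + z)))
      (g z * l y - (g (y + z) - g y * f z))
      (bdd_congr (bdd_comp (bdd_sub (hEb z) (bdd_const_mul (g z) hR)) fun x => (x, y)) fun x => by
          linear_combination assoc x y z - g z * hg x y)
    linear_combination g z * hg x y - assoc x y z + f x * c₁ + g x * c₂
  exact (hfg (T (x, y)) (-R (x, y)) (bdd_congr
    (bdd_sub (bdd_comp hT fun z => (x, y + z)) (bdd_comp hT fun z => (x + y, z))) fun z => by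
      have := hEeq x y z
      simp only [hE] at this
      linear_combination this)).1

/-- Hyers' theorem: a function with bounded Cauchy difference is the sum of an additive function and
a bounded function. -/
theorem exists_additive_of_bdd_cauchy_difference {ψ : G → ℂ}
    (hψ : (fun p : G × G => ψ (p.1 + p.2) - ψ p.1 - ψ p.2) ∈ boundedFunctions (G × G)) :
    ∃ a b : G → ℂ, IsAdditive a ∧ b ∈ boundedFunctions G ∧ ∀ x, ψ x = a x + b x := by
  obtain ⟨C, hC⟩ := hψ
  have hC' : ∀ x y, ‖ψ (x + y) - ψ x - ψ y‖ ≤ C := fun x y => hC (x, y)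
  set s : G → ℕ → ℂ := fun x n => ψ (2 ^ n • x) / 2 ^ n with hs
  -- These bounds sum to `C`, which also bounds the distance from `ψ` to the limit.
  have hstep : ∀ x n, dist (s x n) (s x (n + 1)) ≤ C / 2 / 2 ^ n := by
    intro x n
    have e : s x n - s x (n + 1)
        = -(ψ (2 ^ n • x + 2 ^ n • x) - ψ (2 ^ n • x) - ψ (2 ^ n • x)) / (2 * 2 ^ n) := by
      simp only [hs]
      rw [pow_succ 2 n, mul_comm (2 ^ n) 2, mul_smul, two_smul, pow_succ]
      field_simp
      ring
    rw [dist_eq_norm, e, norm_div, norm_neg, div_div]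
    have : ‖(2 * 2 ^ n : ℂ)‖ = 2 * 2 ^ n := by simp
    rw [this]
    gcongr
    exact hC' _ _
  have hlim : ∀ x, ∃ l, Filter.Tendsto (s x) Filter.atTop (nhds l) := fun x =>
    cauchySeq_tendsto_of_complete (cauchySeq_of_le_geometric_two (hstep x))
  choose a ha using hlim
  refine ⟨a, fun x => ψ x - a x, fun x y => ?_, ⟨C, fun x => ?_⟩, fun x => by ring⟩
  · have h0 : Filter.Tendsto (fun n => s (x + y) n - s x n - s y n) Filter.atTop (nhds 0) := by
      refine squeeze_zero_norm (a := fun n : ℕ => C * (1 / 2 : ℝ) ^ n) (fun n => ?_) ?_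
      · have e : s (x + y) n - s x n - s y n
            = (ψ (2 ^ n • x + 2 ^ n • y) - ψ (2 ^ n • x) - ψ (2 ^ n • y)) / 2 ^ n := by
          simp only [hs, smul_add]
          ring
        rw [e, norm_div, one_div, inv_pow, ← div_eq_mul_inv]
        have : ‖(2 ^ n : ℂ)‖ = 2 ^ n := by simp
        rw [this]
        gcongr
        exact hC' _ _
      · simpa using (tendsto_pow_atTop_nhds_zero_of_lt_one (r := (1 / 2 : ℝ))
          (by norm_num) (by norm_num)).const_mul C
    have := tendsto_nhds_unique h0 (((ha (x + y)).sub (ha x)).sub (ha y))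
    linear_combination -this
  · have := dist_le_of_le_geometric_two_of_tendsto₀ (hstep x) (ha x)
    rw [dist_eq_norm] at this
    simpa [hs] using this

theorem IsMultiplicative.ne_zero_apply {m : G → ℂ} (hm : IsMultiplicative m) (h0 : m ≠ 0)
    (x : G) : m x ≠ 0 := by
  intro hx
  apply h0
  funext y
  have := hm x (y - x)
  rw [add_sub_cancel, hx, zero_mul] at this
  exact this

theorem IsMultiplicative.map_zero {m : G → ℂ} (hm : IsMultiplicative m) (h0 : m ≠ 0) :
    m 0 = 1 := by
  have := hm 0 0
  rw [add_zero] at this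
  exact (mul_right_cancel₀ (hm.ne_zero_apply h0 0) (by rw [one_mul]; exact this)).symm

theorem IsMultiplicative.bdd_inv {m : G → ℂ} (hm : IsMultiplicative m) (h0 : m ≠ 0)
    (hb : m ∈ boundedFunctions G) : (fun x => (m x)⁻¹) ∈ boundedFunctions G :=
  bdd_congr (bdd_comp hb fun x => -x) fun x => by
    refine inv_eq_of_mul_eq_one_right ?_
    rw [← hm, add_neg_cancel, hm.map_zero h0]

/-- The structure of the solutions, up to a bounded defect, of
`f (x + y) = f x * m y + m x * f y + k x * k y` with `m` bounded. -/
theorem exists_of_bdd_coefficient {f k m : G → ℂ} (hfk : IndepPair f k)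
    (hm : m ∈ boundedFunctions G) {T : G × G → ℂ} (hT : T ∈ boundedFunctions (G × G))
    (hf : ∀ x y, f (x + y) = f x * m y + m x * f y + k x * k y + T (x, y)) :
    IsMultiplicative m ∧ ∃ q : ℂ, ∀ x y, k (x + y) = k x * m y + m x * k y + q * k x * k y := by
  have assoc : ∀ x y z, f x * (m y * m z - m (y + z)) + f z * (m (x + y) - m x * m y)
      + k x * (k y * m z - k (y + z)) + k z * (k (x + y) - m x * k y)
      = m x * T (y, z) - T (x, y) * m z + T (x, y + z) - T (x + y, z) := by
    intro x y z
    have e := hf (x + y) z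
    rw [add_assoc, hf x (y + z), hf x y, hf y z] at e
    linear_combination -e
  obtain ⟨w, hw⟩ := hfk.exists_ne_zero
  obtain ⟨μ, ν, R, hμ, hR, hk⟩ : ∃ (μ ν : G → ℂ) (R : G × G → ℂ), μ ∈ boundedFunctions G ∧
      R ∈ boundedFunctions (G × G) ∧
      ∀ x y, k (x + y) = f x * μ y + k x * (ν y + m y) + m x * k y + R (x, y) := by
    refine ⟨fun y => (k w)⁻¹ * (m (y + w) - m y * m w),
      fun y => (k w)⁻¹ * (k (y + w) - k y * m w) - m y,
      fun p => (k w)⁻¹ * (m p.1 * T (p.2, w) - T (p.1, p.2) * m w + T (p.1, p.2 + w)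
        - T (p.1 + p.2, w) - f w * (m (p.1 + p.2) - m p.1 * m p.2)),
      bdd_const_mul _ (bdd_sub (bdd_comp hm fun y => y + w) (bdd_mul_const hm _)),
      bdd_const_mul _ (bdd_sub (bdd_sub (bdd_add (bdd_sub (bdd_mul (bdd_comp hm Prod.fst)
        (bdd_comp hT fun p : G × G => (p.2, w))) (bdd_mul_const hT _)) (bdd_comp hT fun p : G × G => (p.1, p.2 + w)))
        (bdd_comp hT fun p : G × G => (p.1 + p.2, w))) (bdd_const_mul _ (bdd_sub
        (bdd_comp hm fun p : G × G => p.1 + p.2) (bdd_mul (bdd_comp hm Prod.fst)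
        (bdd_comp hm Prod.snd))))), fun x y => ?_⟩
    have := assoc x y w
    field_simp
    linear_combination this
  -- Symmetry of `k (x + y)`: the terms `m x * k y` and `k x * m y` cancel. Setting `y = w` then
  -- determines `ν` up to a bounded function.
  have symm : ∀ x y, f x * μ y + k x * ν y - (f y * μ x + k y * ν x)
      = R (y, x) - R (x, y) := by
    intro x y
    have e := hk y x
    rw [add_comm, hk x y] at e
    linear_combination e
  have hdiff : ∀ y, (fun x => R (y, x) - R (x, y)) ∈ boundedFunctions G := fun y =>
    bdd_sub (bdd_comp hR fun x => (y, x)) (bdd_comp hR fun x => (x, y))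
  obtain ⟨p, q, c, hc, hν⟩ : ∃ (p q : ℂ) (c : G → ℂ), c ∈ boundedFunctions G ∧
      ∀ x, ν x = p * f x + q * k x + c x := by
    refine ⟨(k w)⁻¹ * μ w, (k w)⁻¹ * ν w,
      fun x => (k w)⁻¹ * (-1 * (f w * μ x) - (R (w, x) - R (x, w))),
      bdd_const_mul _ (bdd_sub (bdd_const_mul _ (bdd_const_mul _ hμ)) (hdiff w)), fun x => ?_⟩
    have := symm x w
    field_simp
    linear_combination -this
  have hcoef : ∀ y, μ y - p * k y = 0 ∧ p * f y + c y = 0 := fun y =>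
    hfk _ _ (bdd_congr (bdd_add (hdiff y) (bdd_add (bdd_const_mul (f y) hμ)
      (bdd_const_mul (k y) hc))) fun x => by
        linear_combination symm x y - k x * hν y + k y * hν x)
  -- `μ = p k` is bounded while `k` is not.
  have hp : p = 0 := hfk.eq_zero_of_mul_bdd
    (bdd_congr hμ fun y => by linear_combination -(hcoef y).1)
  subst hp
  have hk' : ∀ x y, k (x + y) = k x * m y + m x * k y + q * k x * k y + R (x, y) := by
    intro x y
    linear_combination hk x y + k x * hν y + f x * (hcoef y).1 + k x * (hcoef y).2
  -- With the law for `k` inserted into `assoc`, these are the coefficients of `f x` and `k x` in a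
  -- bounded function.
  have hzero : ∀ y z, m y * m z - m (y + z) = 0 ∧ -R (y, z) = 0 := fun y z =>
    hfk _ _ (bdd_congr (bdd_sub (bdd_sub (bdd_add (bdd_sub (bdd_mul_const hm (T (y, z)))
      (bdd_mul_const (bdd_comp hT fun x => (x, y)) (m z))) (bdd_comp hT fun x => (x, y + z)))
      (bdd_comp hT fun x => (x + y, z))) (bdd_add (bdd_const_mul (f z) (bdd_sub
      (bdd_comp hm fun x => x + y) (bdd_mul_const hm (m y))))
      (bdd_const_mul (k z) (bdd_comp hR fun x => (x, y))))) fun x => by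
        linear_combination assoc x y z + k x * hk' y z - k z * hk' x y)
  exact ⟨fun y z => by linear_combination -(hzero y z).1, q, fun y z => by
    linear_combination hk' y z - (hzero y z).2⟩

/-- If `m = 0`, setting `y = 0` in both equations makes `q f - k` bounded. -/
theorem coefficient_ne_zero {f k m : G → ℂ} (hfk : IndepPair f k) {q : ℂ}
    (hk : ∀ x y, k (x + y) = k x * m y + m x * k y + q * k x * k y)
    {T : G × G → ℂ} (hT : T ∈ boundedFunctions (G × G))
    (hf : ∀ x y, f (x + y) = f x * m y + m x * f y + k x * k y + T (x, y)) : m ≠ 0 := by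
  rintro rfl
  simp only [Pi.zero_apply, mul_zero, zero_mul, zero_add] at hk hf
  refine one_ne_zero (neg_eq_zero.1 (hfk q (-1) (bdd_congr
    (bdd_const_mul q (bdd_comp hT fun x => (x, 0))) fun x => ?_)).2)
  have h₁ := hk x 0
  have h₂ := hf x 0
  rw [add_zero] at h₁ h₂
  linear_combination q * h₂ - h₁

end Equations

end TrigStability

/-! ### Reduction to the normal forms and case analysis. -/

open TrigStability in
theorem proposition3p4 {G : Type*} [AddCommGroup G] (f g h : G → ℂ)
    (hfh : TrigStability.LinIndepModulo (TrigStability.boundedFunctions G) ![f, h])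
    (hbdd : (fun p : G × G =>
        f (p.1 + p.2) - f p.1 * g p.2 - g p.1 * f p.2 - h p.1 * h p.2) ∈
      TrigStability.boundedFunctions (G × G)) :
    (∃ (f₀ g₀ b : G → ℂ) (ρ l : ℂ),
      b ∈ TrigStability.boundedFunctions G ∧ l ≠ 0 ∧
      (∀ x y, f₀ (x + y) = f₀ x * f₀ y - g₀ x * g₀ y) ∧
      (∀ x, f x = -l ^ 2 * f₀ x + l ^ 2 * b x) ∧
      (∀ x, g x = (1 + ρ ^ 2) / 2 * f₀ x + ρ * g₀ x + (1 - ρ ^ 2) / 2 * b x) ∧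
      (∀ x, h x = l * ρ * f₀ x + l * g₀ x - l * ρ * b x)) ∨
    (∃ (m M a b : G → ℂ) (β l : ℂ),
      TrigStability.IsMultiplicative m ∧ m ≠ 0 ∧ m ∈ TrigStability.boundedFunctions G ∧
      TrigStability.IsMultiplicative M ∧ M ∉ TrigStability.boundedFunctions G ∧
      TrigStability.IsAdditive a ∧ a ≠ 0 ∧
      b ∈ TrigStability.boundedFunctions G ∧ l ≠ 0 ∧
      (∀ x, f x = l ^ 2 * M x + a x * m x + b x) ∧
      (∀ x, g x = β * l * (1 - 1 / 2 * β * l) * M x + (1 - β * l) * m x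
        - 1 / 2 * β ^ 2 * a x * m x - 1 / 2 * β ^ 2 * b x) ∧
      (∀ x, h x = l * (1 - β * l) * M x - l * m x - β * a x * m x - β * b x)) ∨
    (∃ (m a a₁ b : G → ℂ) (β : ℂ),
      TrigStability.IsMultiplicative m ∧ m ≠ 0 ∧ m ∈ TrigStability.boundedFunctions G ∧
      TrigStability.IsAdditive a ∧ a ≠ 0 ∧ TrigStability.IsAdditive a₁ ∧
      b ∈ TrigStability.boundedFunctions G ∧
      (∀ x, f x = 1 / 2 * a x ^ 2 * m x + 1 / 2 * a₁ x * m x + b x) ∧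
      (∀ x, g x = -(1 / 4) * β ^ 2 * a x ^ 2 * m x + β * a x * m x
        - 1 / 4 * β ^ 2 * a₁ x * m x + m x - 1 / 2 * β ^ 2 * b x) ∧
      (∀ x, h x = -(1 / 2) * β * a x ^ 2 * m x + a x * m x
        - 1 / 2 * β * a₁ x * m x - β * b x)) ∨
    (∃ (m a b : G → ℂ) (β : ℂ),
      TrigStability.IsMultiplicative m ∧ m ≠ 0 ∧ m ∈ TrigStability.boundedFunctions G ∧
      TrigStability.IsAdditive a ∧ a ≠ 0 ∧
      b ∈ TrigStability.boundedFunctions G ∧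
      (∀ x y, f (x + y) = f x * m y + m x * f y + (a x * m x + b x) * (a y * m y + b y)) ∧
      (∀ x, g x = -(1 / 2) * β ^ 2 * f x + (1 + β * a x) * m x + β * b x) ∧
      (∀ x, h x = -β * f x + a x * m x + b x)) ∨
    (∀ x y, f (x + y) = f x * g y + g x * f y + h x * h y) := by
  have hpair : IndepPair f h := fun a b hab => by
    have := hfh ![a, b] (bdd_congr hab fun x => by simp)
    exact ⟨this 0, this 1⟩
  set T : G × G → ℂ := fun p =>
    f (p.1 + p.2) - f p.1 * g p.2 - g p.1 * f p.2 - h p.1 * h p.2 with hTdef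
  have hf : ∀ x y, f (x + y) = f x * g y + g x * f y + h x * h y + T (x, y) := fun x y => by
    simp only [hTdef]
    ring
  by_cases hind : ∀ a b c : ℂ, (fun x => a * f x + b * g x + c * h x) ∈ boundedFunctions G →
      a = 0 ∧ b = 0 ∧ c = 0
  · refine Or.inr (Or.inr (Or.inr (Or.inr fun x y => ?_)))
    rw [hf, defect_eq_zero_of_indep hpair hind hbdd hf x y, add_zero]
  obtain ⟨α, β, m, hm, hg⟩ : ∃ (α β : ℂ) (m : G → ℂ), m ∈ boundedFunctions G ∧
      ∀ x, g x = α * f x + β * h x + m x := by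
    push Not at hind
    obtain ⟨a, b, c, habc, hne⟩ := hind
    have hb : b ≠ 0 := by
      rintro rfl
      obtain ⟨ha, hc⟩ := hpair a c (bdd_congr habc fun x => by ring)
      exact hne ha rfl hc
    refine ⟨-a / b, -c / b, _, bdd_const_mul b⁻¹ habc, fun x => ?_⟩
    field_simp
    ring
  -- This shift of `h` removes the mixed terms `f x * h y`.
  set k : G → ℂ := fun x => h x + β * f x with hkdef
  have hk : ∀ x, h x = k x - β * f x := fun x => by simp only [hkdef]; ring
  have hfk : IndepPair f k := fun a b hab => by
    obtain ⟨h₁, h₂⟩ := hpair (a + b * β) b (bdd_congr hab fun x => by simp only [hkdef]; ring)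
    subst h₂
    exact ⟨by simpa using h₁, rfl⟩
  by_cases hδ : 2 * α - β ^ 2 = 0
  · have hα : α = β ^ 2 / 2 := by linear_combination hδ / 2
    subst hα
    have hf' : ∀ x y, f (x + y) = f x * m y + m x * f y + k x * k y + T (x, y) := fun x y => by
      rw [hf, hg, hg, hk, hk]
      ring
    obtain ⟨hmul, q, hkq⟩ := exists_of_bdd_coefficient hfk hm hbdd hf'
    have hm0 := coefficient_ne_zero hfk hkq hbdd hf'
    have hinv := hmul.bdd_inv hm0 hm
    have hne := hmul.ne_zero_apply hm0
    -- the Cauchy difference of `f / m` is `(k / m) ⊗ (k / m)` up to a bounded function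
    have hcauchy : ∀ P : G → ℂ, (∀ x y, k x * k y = m (x + y) * (P (x + y) - P x - P y)) →
        ∃ a b : G → ℂ, IsAdditive a ∧ b ∈ boundedFunctions G ∧
          ∀ x, f x = P x * m x + a x * m x + b x := by
      intro P hP
      obtain ⟨a, b, ha, hb, hab⟩ := exists_additive_of_bdd_cauchy_difference
        (ψ := fun x => f x / m x - P x) (bdd_congr (bdd_mul hbdd
          (bdd_comp hinv fun p : G × G => p.1 + p.2)) fun p => by
            have h₁ := hf' p.1 p.2
            have h₂ := hP p.1 p.2
            have h₃ := hne p.1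
            have h₄ := hne p.2
            simp only [hmul p.1 p.2] at h₂ ⊢
            change _ = T p * _
            field_simp
            linear_combination h₁ + h₂)
      refine ⟨a, fun x => m x * b x, ha, bdd_mul hm hb, fun x => ?_⟩
      have h₁ := hab x
      have h₂ := hne x
      field_simp at h₁
      linear_combination h₁
    by_cases hq : q = 0
    · subst hq
      have hadd : IsAdditive fun x => k x / m x := fun x y => by
        have h₁ := hne x
        have h₂ := hne y
        simp only [hkq x y, hmul x y]
        field_simp
        ring
      -- Half the square of an additive function `u` has Cauchy difference `u x * u y`.
      obtain ⟨a, b, ha, hb, hab⟩ := hcauchy (fun x => 1 / 2 * (k x / m x) ^ 2) fun x y => by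
        have h₁ := hne x
        have h₂ := hne y
        have h₃ := hadd x y
        simp only at h₃ ⊢
        rw [h₃, hmul]
        field_simp
        ring
      have hkm : ∀ x, k x = k x / m x * m x := fun x => (div_mul_cancel₀ _ (hne x)).symm
      refine Or.inr (Or.inr (Or.inl ⟨m, fun x => k x / m x, fun x => 2 * a x, b, β, hmul, hm0, hm,
        hadd, fun h0 => ?_, fun x y => ?_, hb, fun x => ?_, fun x => ?_, fun x => ?_⟩))
      · obtain ⟨z, hz⟩ := hfk.exists_ne_zero
        exact div_ne_zero hz (hne z) (congrFun h0 z)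
      · simp only [ha x y]
        ring
      · rw [hab]
        ring
      · rw [hg, hk]
        linear_combination (-β ^ 2 / 2) * hab x + β * hkm x
      · rw [hk]
        linear_combination -β * hab x + hkm x
    -- Here `u = k / m` satisfies `u (x + y) = u x + u y + q * u x * u y`, so `u / q` has Cauchy
    -- difference `u x * u y`.
    · obtain ⟨a, b, ha, hb, hab⟩ := hcauchy (fun x => k x / (q * m x)) fun x y => by
        have h₁ := hne x
        have h₂ := hne y
        rw [hkq, hmul]
        field_simp
        ring
      -- `M = m + q k` is multiplicative; the surplus multiple of `m` goes into the bounded part.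
      have hf₂ : ∀ x, f x = q⁻¹ ^ 2 * (m x + q * k x) + a x * m x + (b x - q⁻¹ ^ 2 * m x) := by
        intro x
        have h₁ := hne x
        rw [hab]
        field_simp
        ring
      have hk₂ : ∀ x, k x = q⁻¹ * (m x + q * k x) - q⁻¹ * m x := fun x => by
        field_simp
        ring
      have hb₂ := bdd_sub hb (bdd_const_mul (q⁻¹ ^ 2) hm)
      refine Or.inr (Or.inl ⟨m, fun x => m x + q * k x, a, _, β, q⁻¹, hmul, hm0, hm,
        fun x y => ?_, fun hM => ?_, ha, ?_, hb₂, inv_ne_zero hq, hf₂, fun x => ?_, fun x => ?_⟩)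
      · simp only [hkq x y, hmul x y]
        ring
      · exact hq (hfk.eq_zero_of_mul_bdd (bdd_congr (bdd_sub hM hm) fun x => by ring))
      -- With `a = 0`, `f - q⁻¹ k` would be bounded.
      · rintro rfl
        exact one_ne_zero (hfk 1 (-q⁻¹) (bdd_congr hb fun x => by
          rw [hf₂, Pi.zero_apply]
          field_simp
          ring)).1
      · rw [hg, hk]
        linear_combination (-β ^ 2 / 2) * hf₂ x + β * hk₂ x
      · rw [hk]
        linear_combination -β * hf₂ x + hk₂ x
  -- With `s² = -(2α - β²)`, the pair `f₀ = -s² f + m`, `g₀ = s k` satisfies the cosine equation up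
  -- to a bounded term.
  · obtain ⟨s, hs⟩ := IsAlgClosed.exists_pow_nat_eq (-(2 * α - β ^ 2)) two_pos
    have hs0 : s ≠ 0 := by
      rintro rfl
      exact hδ (by linear_combination hs)
    have hα : α = (β ^ 2 - s ^ 2) / 2 := by linear_combination hs / 2
    have hindep : IndepPair (fun x => -s ^ 2 * f x + m x) fun x => s * k x := fun a b hab => by
      obtain ⟨h₁, h₂⟩ := hfk (a * -s ^ 2) (b * s)
        (bdd_congr (bdd_sub hab (bdd_const_mul a hm)) fun x => by ring)
      exact ⟨by simpa [hs0] using h₁, by simpa [hs0] using h₂⟩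
    have hcos : ∀ x y, -s ^ 2 * f (x + y) + m (x + y) = (-s ^ 2 * f x + m x) *
        (-s ^ 2 * f y + m y) - s * k x * (s * k y) +
          (-s ^ 2 * T (x, y) + m (x + y) - m x * m y) := by
      intro x y
      rw [hf, hg, hg, hk, hk, hα]
      ring
    have hzero := cosine_defect_eq_zero hindep (T := fun p =>
      -s ^ 2 * T p + m (p.1 + p.2) - m p.1 * m p.2) (bdd_sub (bdd_add (bdd_const_mul _ hbdd)
        (bdd_comp hm fun p : G × G => p.1 + p.2)) (bdd_mul (bdd_comp hm Prod.fst)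
          (bdd_comp hm Prod.snd))) hcos
    refine Or.inl ⟨fun x => -s ^ 2 * f x + m x, fun x => s * k x, m, β * s⁻¹, s⁻¹, hm,
      inv_ne_zero hs0, fun x y => ?_, fun x => ?_, fun x => ?_, fun x => ?_⟩
    · linear_combination hcos x y + hzero x y
    · field_simp
      ring
    · rw [hg, hk, hα]
      field_simp
      ring
    · rw [hk]
      field_simp
      ring
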